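/- Let $X$ be a finite abstract simplicial complex that is pure $n$-dimensional with $n>1$ (every simplex is contained in an $n$-dimensional simplex); $X^{(k)}$ is the set of $k$-simplices, with $X^{(-1)}=\{\emptyset\}$, and $\Sigma(k)$ is the set of ordered $k$-simplices. Let $m$ be a balanced weight on $X$: a strictly positive function on all simplices of dimension $-1\le k\le n$ such that $m(\tau)=\sum_{\sigma\in X^{(k+1)},\,\tau\subset\sigma}m(\sigma)$ for all $\tau\in X^{(k)}$, $-1\le k\le n-1$. Let $C^k(X,\mathbb R)$ be the space of antisymmetric functions $\Sigma(k)\to\mathbb R$ with inner product $\langle\phi,\psi\rangle=\sum_{\tau\in\Sigma(k)}\frac{m(\tau)}{(k+1)!}\phi(\tau)\psi(\tau)$, let $d_k:C^k(X,\mathbb R)\to C^{k+1}(X,\mathbb R)$ be the differential $(d_k\phi)(v_0,\dots,v_{k+1})=\sum_{i=0}^{k+1}(-1)^i\phi(v_0,\dots,\widehat{v_i},\dots,v_{k+1})$, $\delta_k=d_k^*$ its adjoint, $\Delta_k^+=\delta_kd_k$ and $\Delta_k^-=d_{k-1}\delta_{k-1}$. For a simplex $\tau$ of $X$, the link $X_\tau=\{\sigma:\sigma\cap\tau=\emptyset,\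 \sigma\cup\tau\in X\}$ (so $X_\emptyset=X$) carries the weight $m_\tau(\sigma)=m(\tau\cup\sigma)$, and $\Delta_{\tau,0}^+$ denotes its operator $\Delta_0^+$. Assume that the $1$-skeletons of all links of $X$ of dimension $>0$ (including $X$ itself) are connected, and that there are real numbers $\kappa\ge\lambda>\frac{n-1}{n}$ such that $$\bigcup_{\tau\in X^{(n-2)}}\operatorname{Spec}(\Delta_{\tau,0}^+)\setminus\{0\}\subseteq[\lambda,\kappa].$$ Let $f(x)=2-\frac1x$, let $f^j$ be the $j$-fold composition of $f$ with itself ($f^0(x)=x$), and for $0\le k\le n-1$ put $\lambda_k=f^{n-1-k}(\lambda)$ and $\kappa_k=f^{n-1-k}(\kappa)$. Then for every $0\le k\le n-1$, in operator norm, $$\left\|\Delta_k^++\frac{\lambda_k+\kappa_k}{2}\,\Delta_k^--(k+1)\left(\frac{\lambda_k+\kappa_k}{2}-\frac{k}{k+1}\right)I\right\|\le\frac{k+1}{2}\left(f^{n-1-k}(\kappa)-f^{n-1-k}(\lambda)\right).$$ -/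

import Mathlib

noncomputable section

/-- A finite abstract simplicial complex on (a subset of) the finite set `V`, with a strictly
positive weight function on its simplices. The empty set counts as the unique simplex of
dimension `-1`, and it also carries a weight. The values of `weight` off the simplices of the
complex are never used. -/
structure WeightedComplex (V : Type*) extends PreAbstractSimplicialComplex V where
  /-- the weight function `m` -/
  weight : Finset V → ℝ
  weight_pos : ∀ s : Finset V, s = ∅ ∨ s ∈ faces → 0 < weight s

namespace WeightedComplex

variable {V : Type*} [Fintype V] [DecidableEq V]

open Classical in
/-- All simplices, of all dimensions `≥ -1`. A simplex of dimension `k` has `k + 1` elements. -/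
def simplices (X : WeightedComplex V) : Finset (Finset V) :=
  {s | s = ∅ ∨ s ∈ X.faces}

theorem mem_simplices {X : WeightedComplex V} {s : Finset V} :
    s ∈ X.simplices ↔ s = ∅ ∨ s ∈ X.faces := by
  simp [simplices]

theorem mem_simplices_of_subset {X : WeightedComplex V} {s t : Finset V}
    (hs : s ∈ X.simplices) (hts : t ⊆ s) : t ∈ X.simplices := by
  rw [mem_simplices] at hs ⊢
  rcases t.eq_empty_or_nonempty with ht | ht
  · exact Or.inl ht
  · rcases hs with rfl | hs
    · exact absurd (Finset.subset_empty.1 hts) ht.ne_empty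
    · exact Or.inr ((X.isRelLowerSet_faces hs).2 hts ht)

/-- `X` is pure `n`-dimensional: every simplex is contained in an `n`-dimensional simplex. -/
def IsPure (X : WeightedComplex V) (n : ℕ) : Prop :=
  ∀ s ∈ X.simplices, ∃ t ∈ X.simplices, s ⊆ t ∧ t.card = n + 1

/-- The weight is balanced: `m τ` is the sum of `m σ` over the `(k + 1)`-simplices `σ ⊃ τ`, for
every simplex `τ` of dimension `k ∈ {-1, …, n - 1}`. -/
def IsBalanced (X : WeightedComplex V) (n : ℕ) : Prop :=
  ∀ τ ∈ X.simplices, τ.card ≤ n →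
    ∑ σ ∈ X.simplices with σ.card = τ.card + 1 ∧ τ ⊆ σ, X.weight σ = X.weight τ

/-- The link of a simplex `τ`, with the weight `m_τ σ = m (τ ∪ σ)`. -/
def link (X : WeightedComplex V) (τ : Finset V) (hτ : τ ∈ X.simplices) : WeightedComplex V where
  faces := {s | s.Nonempty ∧ Disjoint τ s ∧ τ ∪ s ∈ X.faces}
  isRelLowerSet_faces := by
    rintro s ⟨hs, hd, hf⟩
    refine ⟨hs, fun t hts ht => ⟨ht, hd.mono_right hts, ?_⟩⟩
    exact (X.isRelLowerSet_faces hf).2 (Finset.union_subset_union_right hts)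
      (ht.mono Finset.subset_union_right)
  weight s := X.weight (τ ∪ s)
  weight_pos := by
    rintro s (rfl | ⟨-, -, hf⟩)
    · rw [Finset.union_empty]
      exact X.weight_pos τ (mem_simplices.1 hτ)
    · exact X.weight_pos _ (Or.inr hf)

/-- The `1`-skeleton, as a graph on the vertices of the complex. -/
def oneSkeleton (X : WeightedComplex V) : SimpleGraph {v : V // {v} ∈ X.simplices} where
  Adj u v := u ≠ v ∧ ({u.1, v.1} : Finset V) ∈ X.simplices
  symm := ⟨fun u v h => ⟨h.1.symm, by rw [Finset.pair_comm]; exact h.2⟩⟩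
  loopless := ⟨fun _ h => h.1 rfl⟩

/-- Ordered simplices with `j` vertices, i.e. `Σ(j - 1)`. -/
def Ordered (X : WeightedComplex V) (j : ℕ) : Type _ :=
  {v : Fin j → V // Function.Injective v ∧ Finset.univ.image v ∈ X.simplices}

instance (X : WeightedComplex V) (j : ℕ) : Fintype (X.Ordered j) :=
  Fintype.ofInjective (fun σ : X.Ordered j => σ.1) Subtype.val_injective

namespace Ordered

variable {X : WeightedComplex V} {j : ℕ}

/-- The underlying simplex of an ordered simplex. -/
def toSimplex (σ : X.Ordered j) : Finset V := Finset.univ.image σ.1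

/-- `(v_{π(0)}, …, v_{π(k)})`. -/
def perm (σ : X.Ordered j) (π : Equiv.Perm (Fin j)) : X.Ordered j :=
  ⟨σ.1 ∘ π, σ.2.1.comp π.injective, by
    rw [← Finset.image_image, Finset.image_univ_equiv]; exact σ.2.2⟩

/-- `(v_0, …, v̂_i, …, v_{k+1})`: the `i`-th vertex is deleted. -/
def face (σ : X.Ordered (j + 1)) (i : Fin (j + 1)) : X.Ordered j :=
  ⟨σ.1 ∘ i.succAbove, σ.2.1.comp Fin.succAbove_right_injective, by
    refine mem_simplices_of_subset σ.2.2 ?_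
    rw [← Finset.image_image]
    exact Finset.image_subset_image (Finset.subset_univ _)⟩

end Ordered

/-- The antisymmetric real functions on ordered simplices with `j` vertices. -/
def formSubmodule (X : WeightedComplex V) (j : ℕ) : Submodule ℝ (X.Ordered j → ℝ) where
  carrier := {φ | ∀ (σ : X.Ordered j) (π : Equiv.Perm (Fin j)),
    φ (σ.perm π) = ((Equiv.Perm.sign π : ℤ) : ℝ) * φ σ}
  add_mem' {a b} ha hb σ π := by simp only [Pi.add_apply, ha σ π, hb σ π]; ring
  zero_mem' σ π := by simp
  smul_mem' c a ha σ π := by simp only [Pi.smul_apply, smul_eq_mul, ha σ π]; ring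

/-- The space of forms `C^{j-1}(X, ℝ)`; thus `X.Form (k + 1)` is the space of `k`-forms. It is a
type of its own because its norm is not the one inherited from the product. -/
def Form (X : WeightedComplex V) (j : ℕ) : Type _ := X.formSubmodule j

section FormInstances

variable (X : WeightedComplex V) (j : ℕ)

instance : AddCommGroup (X.Form j) := inferInstanceAs (AddCommGroup (X.formSubmodule j))

instance : Module ℝ (X.Form j) := inferInstanceAs (Module ℝ (X.formSubmodule j))

instance : FiniteDimensional ℝ (X.Form j) :=
  inferInstanceAs (FiniteDimensional ℝ (X.formSubmodule j))

instance : CoeFun (X.Form j) (fun _ => X.Ordered j → ℝ) := ⟨fun φ => φ.1⟩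

/-- The inner product `⟨φ, ψ⟩ = ∑_{τ ∈ Σ(j-1)} m(τ) / j! · φ(τ) ψ(τ)`. -/
@[reducible] def formCore : InnerProductSpace.Core ℝ (X.Form j) where
  inner φ ψ := ∑ τ : X.Ordered j, X.weight τ.toSimplex / (j.factorial : ℝ) * φ τ * ψ τ
  conj_inner_symm φ ψ := by
    simp only [conj_trivial]
    exact Finset.sum_congr rfl fun τ _ => by ring
  re_inner_nonneg φ := by
    simp only [RCLike.re_to_real]
    refine Finset.sum_nonneg fun τ _ => ?_
    rw [mul_assoc]
    exact mul_nonneg (div_nonneg (X.weight_pos _ (mem_simplices.1 τ.2.2)).le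
      (Nat.cast_nonneg _)) (mul_self_nonneg _)
  add_left φ ψ χ := by
    rw [← Finset.sum_add_distrib]
    refine Finset.sum_congr rfl fun τ _ => ?_
    change _ * (φ τ + ψ τ) * _ = _
    ring
  smul_left φ ψ r := by
    simp only [conj_trivial]
    rw [Finset.mul_sum]
    refine Finset.sum_congr rfl fun τ _ => ?_
    change _ * (r * φ τ) * _ = _
    ring
  definite φ h := by
    have hpos : ∀ τ : X.Ordered j, 0 < X.weight τ.toSimplex / (j.factorial : ℝ) := fun τ =>
      div_pos (X.weight_pos _ (mem_simplices.1 τ.2.2)) (Nat.cast_pos.2 j.factorial_pos)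
    have h0 := (Finset.sum_eq_zero_iff_of_nonneg (fun τ _ => by
      rw [mul_assoc]
      exact mul_nonneg (hpos τ).le (mul_self_nonneg (φ τ)))).1 h
    refine Subtype.ext (funext fun τ => ?_)
    have h1 := h0 τ (Finset.mem_univ τ)
    rw [mul_assoc] at h1
    exact mul_self_eq_zero.1 ((mul_eq_zero.1 h1).resolve_left (hpos τ).ne')

instance : NormedAddCommGroup (X.Form j) := (X.formCore j).toNormedAddCommGroup

instance : InnerProductSpace ℝ (X.Form j) :=
  InnerProductSpace.ofCore (X.formCore j).toCore

end FormInstances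

/-- A permutation of `0, …, j` fixing `0` comes from a permutation of the other indices with the
same sign. -/
theorem exists_perm_succ {j : ℕ} (ρ : Equiv.Perm (Fin (j + 1))) (h : ρ 0 = 0) :
    ∃ e : Equiv.Perm (Fin j), (∀ x, ρ x.succ = (e x).succ) ∧
      Equiv.Perm.sign ρ = Equiv.Perm.sign e := by
  obtain ⟨⟨p, e⟩, rfl⟩ := Equiv.Perm.decomposeFin.symm.surjective ρ
  rw [Equiv.Perm.decomposeFin_symm_apply_zero] at h
  subst h
  refine ⟨e, fun x => ?_, ?_⟩
  · rw [Equiv.Perm.decomposeFin_symm_apply_succ]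
    simp
  · simp

theorem exists_face_perm {X : WeightedComplex V} {j : ℕ} (σ : X.Ordered (j + 1))
    (π : Equiv.Perm (Fin (j + 1))) (i : Fin (j + 1)) :
    ∃ e : Equiv.Perm (Fin j), (σ.perm π).face i = (σ.face (π i)).perm e ∧
      (-1 : ℝ) ^ (i : ℕ) * ((Equiv.Perm.sign e : ℤ) : ℝ) =
        ((Equiv.Perm.sign π : ℤ) : ℝ) * (-1 : ℝ) ^ ((π i : Fin (j + 1)) : ℕ) := by
  obtain ⟨e, he, hs⟩ := exists_perm_succ
    ((π i).cycleRange * π * (i.cycleRange)⁻¹) (by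
      simp [Equiv.Perm.mul_apply, Equiv.Perm.inv_def, Fin.cycleRange_symm_zero])
  refine ⟨e, Subtype.ext (funext fun x => ?_), ?_⟩
  · change σ.1 (π (i.succAbove x)) = σ.1 ((π i).succAbove (e x))
    have h1 := he x
    rw [Equiv.Perm.mul_apply, Equiv.Perm.mul_apply, Equiv.Perm.inv_def,
      Fin.cycleRange_symm_succ] at h1
    rw [← Fin.cycleRange_symm_succ (π i) (e x), ← h1, Equiv.symm_apply_apply]
  · rw [← hs]
    simp only [Equiv.Perm.sign_mul, Equiv.Perm.sign_inv, Fin.sign_cycleRange]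
    push_cast
    have h1 : (-1 : ℝ) ^ (i : ℕ) * (-1 : ℝ) ^ (i : ℕ) = 1 := by
      rw [← mul_pow]; norm_num
    linear_combination ((-1 : ℝ) ^ ((π i : Fin (j + 1)) : ℕ)) *
      ((Equiv.Perm.sign π : ℤ) : ℝ) * h1

theorem d_antisymm {X : WeightedComplex V} {j : ℕ} {φ : X.Ordered j → ℝ}
    (hφ : φ ∈ X.formSubmodule j) :
    (fun σ : X.Ordered (j + 1) => ∑ i : Fin (j + 1), (-1 : ℝ) ^ (i : ℕ) * φ (σ.face i)) ∈
      X.formSubmodule (j + 1) := by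
  intro σ π
  change ∑ i : Fin (j + 1), (-1 : ℝ) ^ (i : ℕ) * φ ((σ.perm π).face i) =
    _ * ∑ i : Fin (j + 1), (-1 : ℝ) ^ (i : ℕ) * φ (σ.face i)
  rw [← Equiv.sum_comp π (fun i : Fin (j + 1) => (-1 : ℝ) ^ (i : ℕ) * φ (σ.face i)),
    Finset.mul_sum]
  refine Finset.sum_congr rfl fun i _ => ?_
  obtain ⟨e, he, hs⟩ := exists_face_perm σ π i
  rw [he, hφ (σ.face (π i)) e, ← mul_assoc, hs, mul_assoc]

/-- The differential
`(dφ)(v_0, …, v_j) = ∑_i (-1)^i φ(v_0, …, v̂_i, …, v_j)` from `C^{j-1}` to `C^j`. -/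
def d (X : WeightedComplex V) (j : ℕ) : X.Form j →ₗ[ℝ] X.Form (j + 1) where
  toFun φ := ⟨fun σ => ∑ i : Fin (j + 1), (-1 : ℝ) ^ (i : ℕ) * φ (σ.face i), d_antisymm φ.2⟩
  map_add' φ ψ := by
    refine Subtype.ext (funext fun σ => ?_)
    change ∑ i : Fin (j + 1), (-1 : ℝ) ^ (i : ℕ) * (φ (σ.face i) + ψ (σ.face i)) =
      (∑ i : Fin (j + 1), (-1 : ℝ) ^ (i : ℕ) * φ (σ.face i)) +
        ∑ i : Fin (j + 1), (-1 : ℝ) ^ (i : ℕ) * ψ (σ.face i)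
    rw [← Finset.sum_add_distrib]
    exact Finset.sum_congr rfl fun i _ => by ring
  map_smul' r φ := by
    refine Subtype.ext (funext fun σ => ?_)
    change ∑ i : Fin (j + 1), (-1 : ℝ) ^ (i : ℕ) * (r * φ (σ.face i)) =
      r * ∑ i : Fin (j + 1), (-1 : ℝ) ^ (i : ℕ) * φ (σ.face i)
    rw [Finset.mul_sum]
    exact Finset.sum_congr rfl fun i _ => by ring

/-- The codifferential, the adjoint of `d` for the weighted inner products. -/
def codiff (X : WeightedComplex V) (j : ℕ) : X.Form (j + 1) →ₗ[ℝ] X.Form j :=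
  LinearMap.adjoint (X.d j)

/-- The upper Laplacian `Δ⁺_k = δ_k d_k` on `k`-forms. -/
def upperLaplacian (X : WeightedComplex V) (k : ℕ) : Module.End ℝ (X.Form (k + 1)) :=
  X.codiff (k + 1) ∘ₗ X.d (k + 1)

/-- The lower Laplacian `Δ⁻_k = d_{k-1} δ_{k-1}` on `k`-forms. -/
def lowerLaplacian (X : WeightedComplex V) (k : ℕ) : Module.End ℝ (X.Form (k + 1)) :=
  X.d k ∘ₗ X.codiff k

end WeightedComplex

/-- The function `f(x) = 2 - 1/x`. -/
def descentMap (x : ℝ) : ℝ := 2 - 1 / x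

end

/-! This is Garland's method. A `k`-form `φ` restricts, for each tuple `τ` of `k` vertices, to the
function `g v = φ(v, τ)` on the vertices of the link of `τ`. Writing `A`, `B`, `D` for the sums over
`τ` of `∑ m(v,τ) g(v)²`, `∑ m(v,u,τ) g(v) g(u)` and `(∑ m(v,τ) g(v))² / m(τ)`, one finds `k!⟨φ, φ⟩ =
A/(k+1)`, `k!⟨φ, Δ⁺φ⟩ = A/(k+1) - B` and `k!⟨φ, Δ⁻φ⟩ = D` (`inner_d_d`, `norm_codiff_sq`). The
energies of the `g` add up to `A - B` and their variances to `A - D`. If the nonzero link spectrum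
lies in `[a, b]`, then `a(A - D) ≤ A - B ≤ b(A - D)`. With `c = (a + b)/2` this gives `|A - B - c(A
- D)| ≤ (b - a)/2 · A`, because `D ≥ 0`; the left side is `k!` times the quadratic form of the
operator in question (`LocalGap.inner_bounds`). A symmetric operator is bounded in norm by its
quadratic form.

The link gap is assumed only in dimension `n - 2` and descends to smaller simplices
(`LocalGap.descend`). An eigenfunction with eigenvalue `μ ≠ 0` in the link of `τ`, localized to the
links of all `(w, τ)`, has total energy `μN` and total variance `μ(2 - μ)N`, where `N` is its
squared norm. Hence `a(2 - μ) ≤ 1 ≤ b(2 - μ)`, that is, `f(a) ≤ μ ≤ f(b)`. -/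

set_option linter.unusedSectionVars false

/-! ### Forms and Laplacians as weighted sums over all tuples of vertices -/

namespace WeightedComplex

variable {V : Type*} [Fintype V] [DecidableEq V]

/-- The condition on a tuple of vertices to be an ordered simplex. -/
def IsOrdered (X : WeightedComplex V) {j : ℕ} (σ : Fin j → V) : Prop :=
  Function.Injective σ ∧ Finset.univ.image σ ∈ X.simplices

open Classical in
/-- The weight of a tuple of vertices, zero if it is not an ordered simplex. -/
noncomputable def tupleWeight (X : WeightedComplex V) {j : ℕ} (σ : Fin j → V) : ℝ :=
  if X.IsOrdered σ then X.weight (Finset.univ.image σ) else 0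

open Classical in
/-- The extension of a form by zero to all tuples of vertices. -/
noncomputable def extend {X : WeightedComplex V} {j : ℕ} (φ : X.Form j) (σ : Fin j → V) : ℝ :=
  if h : X.IsOrdered σ then φ ⟨σ, h⟩ else 0

section Tuples

variable {X : WeightedComplex V} {j : ℕ}

theorem IsOrdered.comp_perm {σ : Fin j → V} (h : X.IsOrdered σ) (π : Equiv.Perm (Fin j)) :
    X.IsOrdered (σ ∘ π) :=
  (Ordered.perm ⟨σ, h⟩ π).2

theorem isOrdered_comp_perm {σ : Fin j → V} {π : Equiv.Perm (Fin j)} :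
    X.IsOrdered (σ ∘ π) ↔ X.IsOrdered σ := by
  refine ⟨fun h => ?_, fun h => h.comp_perm π⟩
  have := h.comp_perm π⁻¹
  rwa [Function.comp_assoc, ← Equiv.Perm.coe_mul, mul_inv_cancel, Equiv.Perm.coe_one,
    Function.comp_id] at this

theorem image_cons (v : V) (τ : Fin j → V) :
    Finset.univ.image (Fin.cons v τ : Fin (j + 1) → V) = insert v (Finset.univ.image τ) := by
  ext x
  simp [Fin.exists_fin_succ, eq_comm]

theorem isOrdered_cons {v : V} {τ : Fin j → V} :
    X.IsOrdered (Fin.cons v τ : Fin (j + 1) → V) ↔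
      v ∉ Finset.univ.image τ ∧ Function.Injective τ ∧
        insert v (Finset.univ.image τ) ∈ X.simplices := by
  rw [IsOrdered, image_cons, Fin.cons_injective_iff]
  simp [and_assoc]

theorem IsOrdered.tail {v : V} {τ : Fin j → V}
    (h : X.IsOrdered (Fin.cons v τ : Fin (j + 1) → V)) : X.IsOrdered τ := by
  obtain ⟨-, h1, h2⟩ := isOrdered_cons.1 h
  exact ⟨h1, mem_simplices_of_subset h2 (Finset.subset_insert _ _)⟩

theorem tupleWeight_of_isOrdered {σ : Fin j → V} (h : X.IsOrdered σ) :
    X.tupleWeight σ = X.weight (Finset.univ.image σ) := if_pos h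

theorem tupleWeight_of_not {σ : Fin j → V} (h : ¬ X.IsOrdered σ) :
    X.tupleWeight σ = 0 := if_neg h

theorem tupleWeight_pos {σ : Fin j → V} (h : X.IsOrdered σ) : 0 < X.tupleWeight σ := by
  rw [tupleWeight_of_isOrdered h]
  exact X.weight_pos _ (mem_simplices.1 h.2)

theorem tupleWeight_nonneg (σ : Fin j → V) : 0 ≤ X.tupleWeight σ := by
  by_cases h : X.IsOrdered σ
  · exact (tupleWeight_pos h).le
  · rw [tupleWeight_of_not h]

theorem tupleWeight_cons_eq_zero {τ : Fin j → V} (h : ¬ X.IsOrdered τ) (v : V) :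
    X.tupleWeight (Fin.cons v τ : Fin (j + 1) → V) = 0 :=
  tupleWeight_of_not fun h' => h h'.tail

theorem tupleWeight_comp_perm (σ : Fin j → V) (π : Equiv.Perm (Fin j)) :
    X.tupleWeight (σ ∘ π) = X.tupleWeight σ := by
  simp only [tupleWeight, isOrdered_comp_perm]
  rw [← Finset.image_image, Finset.image_univ_equiv]
  by_cases h : X.IsOrdered σ
  · rw [if_pos h, if_pos (isOrdered_comp_perm.2 h)]
  · rw [if_neg h, if_neg (mt isOrdered_comp_perm.1 h)]

theorem cons_comp_perm (v : V) (τ : Fin j → V) (π : Equiv.Perm (Fin j)) :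
    (Fin.cons v (τ ∘ π) : Fin (j + 1) → V) =
      (Fin.cons v τ : Fin (j + 1) → V) ∘ Equiv.Perm.decomposeFin.symm (0, π) := by
  funext x
  refine Fin.cases ?_ (fun x => ?_) x
  · simp
  · simp [Equiv.Perm.decomposeFin_symm_apply_succ]

theorem tupleWeight_cons_comp_perm (v : V) (τ : Fin j → V) (π : Equiv.Perm (Fin j)) :
    X.tupleWeight (Fin.cons v (τ ∘ π) : Fin (j + 1) → V) =
      X.tupleWeight (Fin.cons v τ : Fin (j + 1) → V) := by
  rw [cons_comp_perm, tupleWeight_comp_perm]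

theorem tupleWeight_cons_cons_comm (u v : V) (τ : Fin j → V) :
    X.tupleWeight (Fin.cons u (Fin.cons v τ) : Fin (j + 2) → V) =
      X.tupleWeight (Fin.cons v (Fin.cons u τ) : Fin (j + 2) → V) := by
  rw [← tupleWeight_comp_perm (Fin.cons v (Fin.cons u τ) : Fin (j + 2) → V) (Equiv.swap 0 1)]
  congr 1
  funext x
  refine Fin.cases ?_ (fun x => ?_) x
  · simp
  · refine Fin.cases ?_ (fun x => ?_) x
    · simp
    · rw [Function.comp_apply, Equiv.swap_apply_of_ne_of_ne]
      · simp
      · exact Fin.succ_ne_zero _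
      · rw [← Fin.succ_zero_eq_one, Ne, Fin.succ_inj]
        exact Fin.succ_ne_zero _

theorem extend_of_isOrdered (φ : X.Form j) {σ : Fin j → V} (h : X.IsOrdered σ) :
    extend φ σ = φ ⟨σ, h⟩ := dif_pos h

theorem extend_of_not (φ : X.Form j) {σ : Fin j → V} (h : ¬ X.IsOrdered σ) :
    extend φ σ = 0 := dif_neg h

theorem extend_comp_perm (φ : X.Form j) (σ : Fin j → V) (π : Equiv.Perm (Fin j)) :
    extend φ (σ ∘ π) = ((Equiv.Perm.sign π : ℤ) : ℝ) * extend φ σ := by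
  by_cases h : X.IsOrdered σ
  · rw [extend_of_isOrdered φ h, extend_of_isOrdered φ (h.comp_perm π)]
    exact φ.2 ⟨σ, h⟩ π
  · rw [extend_of_not φ h, extend_of_not φ (by rwa [isOrdered_comp_perm]), mul_zero]

theorem extend_cons_comp_perm (φ : X.Form (j + 1)) (v : V) (τ : Fin j → V)
    (π : Equiv.Perm (Fin j)) :
    extend φ (Fin.cons v (τ ∘ π)) = ((Equiv.Perm.sign π : ℤ) : ℝ) * extend φ (Fin.cons v τ) := by
  rw [cons_comp_perm, extend_comp_perm]
  simp

theorem extend_smul (r : ℝ) (φ : X.Form j) (σ : Fin j → V) :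
    extend (r • φ) σ = r * extend φ σ := by
  by_cases h : X.IsOrdered σ
  · rw [extend_of_isOrdered _ h, extend_of_isOrdered _ h]
    rfl
  · simp [extend_of_not _ h]

theorem form_ext {φ ψ : X.Form j} (h : ∀ σ, X.IsOrdered σ → extend φ σ = extend ψ σ) :
    φ = ψ := by
  refine Subtype.ext (funext fun σ => ?_)
  have := h σ.1 σ.2
  rwa [extend_of_isOrdered φ σ.2, extend_of_isOrdered ψ σ.2] at this

theorem inner_eq_sum (φ ψ : X.Form j) :
    inner ℝ φ ψ =
      (1 / (j.factorial : ℝ)) * ∑ σ : Fin j → V, X.tupleWeight σ * extend φ σ * extend ψ σ := by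
  change ∑ τ : X.Ordered j, X.weight τ.toSimplex / (j.factorial : ℝ) * φ τ * ψ τ = _
  rw [Finset.mul_sum]
  refine Fintype.sum_of_injective (fun τ : X.Ordered j => τ.1) Subtype.val_injective _ _ ?_ ?_
  · intro σ hσ
    rw [tupleWeight_of_not]
    · simp
    · exact fun h => hσ ⟨⟨σ, h⟩, rfl⟩
  · intro τ
    rw [tupleWeight_of_isOrdered τ.2, extend_of_isOrdered φ τ.2, extend_of_isOrdered ψ τ.2,
      Ordered.toSimplex]
    change _ / _ * φ τ * ψ τ = 1 / _ * (_ * φ τ * ψ τ)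
    ring

theorem extend_d (φ : X.Form j) {σ : Fin (j + 1) → V} (h : X.IsOrdered σ) :
    extend (X.d j φ) σ = ∑ i : Fin (j + 1), (-1 : ℝ) ^ (i : ℕ) * extend φ (σ ∘ i.succAbove) := by
  rw [extend_of_isOrdered _ h]
  change ∑ i : Fin (j + 1), (-1 : ℝ) ^ (i : ℕ) * φ (Ordered.face ⟨σ, h⟩ i) = _
  refine Finset.sum_congr rfl fun i _ => ?_
  exact congrArg _ (extend_of_isOrdered φ (Ordered.face ⟨σ, h⟩ i).2).symm

theorem sum_tuple_succ (F : (Fin (j + 1) → V) → ℝ) :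
    ∑ σ, F σ = ∑ τ : Fin j → V, ∑ v : V, F (Fin.cons v τ) := by
  rw [← (Fin.consEquiv (fun _ : Fin (j + 1) => V)).sum_comp F, Fintype.sum_prod_type_right]
  rfl

/-- All `j + 1` terms contribute equally: reindexing the tuples by the cycle that brings index `i`
to the front turns the `i`-th deletion into the deletion of the first entry, and the sign this
produces in `ψ` cancels `(-1)^i`. -/
theorem sum_mul_alternating_sum {W ψ : (Fin (j + 1) → V) → ℝ} (χ : (Fin j → V) → ℝ)
    (hW : ∀ σ (π : Equiv.Perm (Fin (j + 1))), W (σ ∘ π) = W σ)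
    (hψ : ∀ σ (π : Equiv.Perm (Fin (j + 1))),
      ψ (σ ∘ π) = ((Equiv.Perm.sign π : ℤ) : ℝ) * ψ σ) :
    ∑ σ, W σ * ψ σ * ∑ i : Fin (j + 1), (-1 : ℝ) ^ (i : ℕ) * χ (σ ∘ i.succAbove) =
      ((j : ℝ) + 1) * ∑ σ, W σ * ψ σ * χ (σ ∘ Fin.succ) := by
  simp_rw [Finset.mul_sum]
  rw [Finset.sum_comm]
  have key : ∀ i : Fin (j + 1),
      ∑ σ : Fin (j + 1) → V, W σ * ψ σ * ((-1 : ℝ) ^ (i : ℕ) * χ (σ ∘ i.succAbove)) =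
        ∑ σ, W σ * ψ σ * χ (σ ∘ Fin.succ) := by
    intro i
    rw [← (i.cycleRange.symm.arrowCongr (Equiv.refl V)).sum_comp]
    refine Finset.sum_congr rfl fun σ _ => ?_
    have h1 : (i.cycleRange.symm.arrowCongr (Equiv.refl V)) σ = σ ∘ i.cycleRange := by
      funext x; simp [Equiv.arrowCongr]
    have h2 : (σ ∘ i.cycleRange) ∘ i.succAbove = σ ∘ Fin.succ := by
      funext x; simp [Fin.cycleRange_succAbove]
    have h3 : (-1 : ℝ) ^ (i : ℕ) * (-1 : ℝ) ^ (i : ℕ) = 1 := by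
      rw [← mul_pow]; norm_num
    rw [h1, h2, hW, hψ, Fin.sign_cycleRange]
    push_cast
    linear_combination (W σ * ψ σ * χ (σ ∘ Fin.succ)) * h3
  rw [Finset.sum_congr rfl fun i _ => key i]
  simp [Finset.mul_sum]

/-- The factor `j + 1` from the alternating sum reduces `(j + 1)!` to `j!`, so the adjoint of `d`
can be read off. -/
theorem inner_d_right (ψ : X.Form (j + 1)) (φ : X.Form j) :
    inner ℝ ψ (X.d j φ) = (1 / (j.factorial : ℝ)) * ∑ τ : Fin j → V, ∑ v : V,
      X.tupleWeight (Fin.cons v τ : Fin (j + 1) → V) * extend ψ (Fin.cons v τ) * extend φ τ := by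
  rw [inner_eq_sum]
  have h1 : ∀ σ : Fin (j + 1) → V, X.tupleWeight σ * extend ψ σ * extend (X.d j φ) σ =
      X.tupleWeight σ * extend ψ σ *
        ∑ i : Fin (j + 1), (-1 : ℝ) ^ (i : ℕ) * extend φ (σ ∘ i.succAbove) := by
    intro σ
    by_cases h : X.IsOrdered σ
    · rw [extend_d φ h]
    · simp [tupleWeight_of_not h]
  rw [Finset.sum_congr rfl fun σ _ => h1 σ,
    sum_mul_alternating_sum (extend φ) tupleWeight_comp_perm (extend_comp_perm ψ),
    sum_tuple_succ, Nat.factorial_succ]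
  simp only [Fin.cons_comp_succ]
  have : (j.factorial : ℝ) ≠ 0 := Nat.cast_ne_zero.2 j.factorial_ne_zero
  have : (j : ℝ) + 1 ≠ 0 := by positivity
  push_cast
  field_simp

theorem cons_comp_succAbove_succ (v : V) (τ : Fin (j + 1) → V) (i : Fin (j + 1)) :
    (Fin.cons v τ : Fin (j + 2) → V) ∘ Fin.succAbove i.succ =
      Fin.cons v (τ ∘ i.succAbove) := by
  funext x
  refine Fin.cases ?_ (fun x => ?_) x <;> simp

/-- Expand `dψ(v, τ)` as `ψ(τ)` minus the terms that keep `v`. Balance sums the first part over `v`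
to `⟨ψ, φ⟩`; antisymmetry of `φ` merges the others. Balance is required only at this one level, so
that the formula also serves in links. -/
theorem inner_d_d (hbal : ∀ τ : Fin (j + 1) → V,
      ∑ v, X.tupleWeight (Fin.cons v τ : Fin (j + 2) → V) = X.tupleWeight τ)
    (ψ φ : X.Form (j + 1)) :
    inner ℝ (X.d (j + 1) ψ) (X.d (j + 1) φ) =
      inner ℝ ψ φ - (1 / (j.factorial : ℝ)) * ∑ τ : Fin j → V, ∑ u : V, ∑ v : V,
        X.tupleWeight (Fin.cons v (Fin.cons u τ) : Fin (j + 2) → V) *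
          extend ψ (Fin.cons v τ) * extend φ (Fin.cons u τ) := by
  rw [inner_d_right, inner_eq_sum]
  have h1 : ∀ (τ : Fin (j + 1) → V) (v : V),
      X.tupleWeight (Fin.cons v τ : Fin (j + 2) → V) * extend (X.d (j + 1) ψ) (Fin.cons v τ) *
        extend φ τ =
      X.tupleWeight (Fin.cons v τ : Fin (j + 2) → V) * (extend ψ τ * extend φ τ) -
      X.tupleWeight (Fin.cons v τ : Fin (j + 2) → V) * extend φ τ *
        ∑ i : Fin (j + 1), (-1 : ℝ) ^ (i : ℕ) * extend ψ (Fin.cons v (τ ∘ i.succAbove)) := by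
    intro τ v
    by_cases h : X.IsOrdered (Fin.cons v τ : Fin (j + 2) → V)
    · rw [extend_d ψ h, Fin.sum_univ_succ]
      simp only [cons_comp_succAbove_succ, Fin.succAbove_zero, Fin.cons_comp_succ, Fin.val_zero,
        pow_zero, one_mul, Fin.val_succ, pow_succ, mul_neg, mul_one, neg_mul,
        Finset.sum_neg_distrib]
      ring
    · simp [tupleWeight_of_not h]
  simp_rw [h1, Finset.sum_sub_distrib, ← Finset.sum_mul, hbal]
  rw [Finset.sum_comm (s := (Finset.univ : Finset (Fin (j + 1) → V)))]
  rw [Finset.sum_congr rfl fun v _ => sum_mul_alternating_sum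
    (W := fun τ => X.tupleWeight (Fin.cons v τ : Fin (j + 2) → V))
    (fun τ => extend ψ (Fin.cons v τ)) (tupleWeight_cons_comp_perm v) (extend_comp_perm φ)]
  have h2 : ∀ v : V, ∑ σ : Fin (j + 1) → V, X.tupleWeight (Fin.cons v σ : Fin (j + 2) → V) *
      extend φ σ * extend ψ (Fin.cons v (σ ∘ Fin.succ)) = ∑ τ : Fin j → V, ∑ u : V,
        X.tupleWeight (Fin.cons v (Fin.cons u τ) : Fin (j + 2) → V) *
          extend ψ (Fin.cons v τ) * extend φ (Fin.cons u τ) := by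
    intro v
    rw [sum_tuple_succ]
    refine Finset.sum_congr rfl fun τ _ => Finset.sum_congr rfl fun u _ => ?_
    rw [Fin.cons_comp_succ]
    ring
  rw [Finset.sum_congr rfl fun v _ => congrArg _ (h2 v), ← Finset.mul_sum]
  have h3 : ∀ G : V → (Fin j → V) → V → ℝ,
      ∑ v, ∑ τ, ∑ u, G v τ u = ∑ τ, ∑ u, ∑ v, G v τ u := by
    intro G
    rw [Finset.sum_comm]
    exact Finset.sum_congr rfl fun τ _ => Finset.sum_comm
  rw [h3, Nat.factorial_succ]
  have : (j.factorial : ℝ) ≠ 0 := Nat.cast_ne_zero.2 j.factorial_ne_zero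
  have : (j : ℝ) + 1 ≠ 0 := by positivity
  push_cast
  field_simp
  simp only [Finset.sum_mul]

/-- The codifferential is explicit: at `τ` it is the sum of `φ(v, τ)` weighted by `m(v, τ) / m(τ)`.
This candidate is antisymmetric and satisfies the adjoint identity against every form. -/
theorem norm_codiff_sq (φ : X.Form (j + 1)) :
    inner ℝ (X.codiff j φ) (X.codiff j φ) = (1 / (j.factorial : ℝ)) * ∑ τ : Fin j → V,
      (∑ v : V, X.tupleWeight (Fin.cons v τ : Fin (j + 1) → V) * extend φ (Fin.cons v τ)) ^ 2 /
        X.tupleWeight τ := by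
  set S : (Fin j → V) → ℝ := fun τ =>
    ∑ v : V, X.tupleWeight (Fin.cons v τ : Fin (j + 1) → V) * extend φ (Fin.cons v τ) with hS
  have hanti : (fun τ : X.Ordered j => S τ.1 / X.tupleWeight τ.1) ∈ X.formSubmodule j := by
    intro τ π
    change S (τ.1 ∘ π) / X.tupleWeight (τ.1 ∘ π) = _ * (S τ.1 / X.tupleWeight τ.1)
    rw [tupleWeight_comp_perm, ← mul_div_assoc, hS, Finset.mul_sum]
    refine congrArg (· / _) (Finset.sum_congr rfl fun v _ => ?_)
    rw [tupleWeight_cons_comp_perm, extend_cons_comp_perm]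
    ring
  set η : X.Form j := ⟨_, hanti⟩ with hη
  have hext : ∀ τ : Fin j → V, X.tupleWeight τ * extend η τ = S τ := by
    intro τ
    by_cases h : X.IsOrdered τ
    · rw [extend_of_isOrdered η h]
      exact mul_div_cancel₀ _ (tupleWeight_pos h).ne'
    · rw [tupleWeight_of_not h, zero_mul, hS]
      exact (Finset.sum_eq_zero fun v _ => by rw [tupleWeight_cons_eq_zero h, zero_mul]).symm
  have hadj : X.codiff j φ = η := by
    refine ext_inner_right ℝ fun ψ => ?_
    rw [codiff, LinearMap.adjoint_inner_left, inner_d_right, inner_eq_sum]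
    refine congrArg _ (Finset.sum_congr rfl fun τ _ => ?_)
    rw [hext, ← Finset.sum_mul]
  rw [hadj, inner_eq_sum]
  refine congrArg _ (Finset.sum_congr rfl fun τ _ => ?_)
  change _ = S τ ^ 2 / _
  rw [← hext]
  -- For vanishing weight both sides are zero, by the convention `x / 0 = 0`.
  by_cases h : X.tupleWeight τ = 0
  · simp [h]
  · field_simp

end Tuples

/-- Adding a vertex `v` to the underlying simplex is a bijection from the `v` with ordered `(v, τ)`
to the cofaces of codimension one, so no factorials appear. -/
theorem IsBalanced.sum_tupleWeight_cons {X : WeightedComplex V} {n j : ℕ} (hbal : X.IsBalanced n)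
    (hj : j ≤ n) (τ : Fin j → V) :
    ∑ v, X.tupleWeight (Fin.cons v τ : Fin (j + 1) → V) = X.tupleWeight τ := by
  classical
  by_cases h : X.IsOrdered τ
  · set T := Finset.univ.image τ with hT
    have hcard : T.card = j := by
      rw [hT, Finset.card_image_of_injective _ h.1, Finset.card_univ, Fintype.card_fin]
    rw [tupleWeight_of_isOrdered h, ← hbal T h.2 (hcard.trans_le hj)]
    rw [← Finset.sum_filter_add_sum_filter_not Finset.univ
      (fun v => X.IsOrdered (Fin.cons v τ : Fin (j + 1) → V)),
      Finset.sum_eq_zero (s := Finset.univ.filter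
        fun v => ¬ X.IsOrdered (Fin.cons v τ : Fin (j + 1) → V))
        (fun v hv => tupleWeight_of_not (Finset.mem_filter.1 hv).2), add_zero]
    refine Finset.sum_nbij (fun v => insert v T) ?_ ?_ ?_ ?_
    · intro v hv
      obtain ⟨h1, -, h2⟩ := isOrdered_cons.1 (Finset.mem_filter.1 hv).2
      exact Finset.mem_filter.2 ⟨h2, Finset.card_insert_of_notMem h1, Finset.subset_insert _ _⟩
    · intro u hu v hv huv
      obtain ⟨h1, -, -⟩ := isOrdered_cons.1 (Finset.mem_filter.1 hu).2
      have h2 : u ∈ insert v T := by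
        rw [← show insert u T = insert v T from huv]
        exact Finset.mem_insert_self u T
      exact (Finset.mem_insert.1 h2).resolve_right h1
    · intro s hs
      obtain ⟨h1, h2, h3⟩ := Finset.mem_filter.1 (Finset.mem_coe.1 hs)
      obtain ⟨v, hv, rfl⟩ := Finset.exists_eq_insert_iff.2 ⟨h3, h2.symm⟩
      exact ⟨v, Finset.mem_coe.2 (Finset.mem_filter.2
        ⟨Finset.mem_univ _, isOrdered_cons.2 ⟨hv, h.1, h1⟩⟩), rfl⟩
    · intro v hv
      rw [tupleWeight_of_isOrdered (Finset.mem_filter.1 hv).2, image_cons]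
  · rw [tupleWeight_of_not h]
    exact Finset.sum_eq_zero fun v _ => tupleWeight_cons_eq_zero h v

end WeightedComplex

/-! ### Quadratic forms of symmetric operators -/

section Symmetric

variable {E : Type*} [NormedAddCommGroup E] [InnerProductSpace ℝ E] [FiniteDimensional ℝ E]

theorem LinearMap.IsSymmetric.inner_apply_self_eq_sum {T : E →ₗ[ℝ] E} (hT : T.IsSymmetric)
    (x : E) :
    inner ℝ x (T x) = ∑ i, hT.eigenvalues rfl i * inner ℝ (hT.eigenvectorBasis rfl i) x ^ 2 := by
  rw [← (hT.eigenvectorBasis rfl).sum_inner_mul_inner]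
  refine Finset.sum_congr rfl fun i _ => ?_
  rw [← hT, hT.apply_eigenvectorBasis, real_inner_smul_left, real_inner_comm]
  simp only [RCLike.ofReal_real_eq_id, id_eq]
  ring

/-- A symmetric operator is bounded by the bound of its quadratic form. -/
theorem LinearMap.IsSymmetric.norm_le_of_abs_inner_le {T : E →ₗ[ℝ] E} (hT : T.IsSymmetric)
    {C : ℝ} (hC : 0 ≤ C) (h : ∀ x, |inner ℝ x (T x)| ≤ C * inner ℝ x x) :
    ‖LinearMap.toContinuousLinearMap T‖ ≤ C := by
  refine ContinuousLinearMap.opNorm_le_bound _ hC fun x => ?_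
  rw [LinearMap.coe_toContinuousLinearMap']
  refine (pow_le_pow_iff_left₀ (norm_nonneg _) (by positivity) two_ne_zero).1 ?_
  set b := hT.eigenvectorBasis rfl
  rw [mul_pow, ← b.sum_sq_norm_inner_right, ← b.sum_sq_norm_inner_right, Finset.mul_sum]
  refine Finset.sum_le_sum fun i _ => ?_
  have h1 : |hT.eigenvalues rfl i| ≤ C := by
    have := h (b i)
    rw [hT.apply_eigenvectorBasis, real_inner_smul_right, real_inner_self_eq_norm_sq,
      b.norm_eq_one] at this
    simpa using this
  rw [← hT, hT.apply_eigenvectorBasis, real_inner_smul_left, norm_mul, mul_pow]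
  refine mul_le_mul_of_nonneg_right ?_ (sq_nonneg _)
  exact pow_le_pow_left₀ (norm_nonneg _) h1 2

/-- If the kernel of a symmetric operator is spanned by `e` and its nonzero eigenvalues lie in
`[a, b]`, then its quadratic form is pinched between `a` and `b` times the squared distance
to `e`. -/
theorem LinearMap.IsSymmetric.inner_apply_self_mem_Icc {T : E →ₗ[ℝ] E} (hT : T.IsSymmetric)
    {e : E} (he : e ≠ 0) (hTe : T e = 0) (hker : ∀ x, T x = 0 → ∃ c : ℝ, x = c • e) {a b : ℝ}
    (hev : ∀ (μ : ℝ) (x : E), μ ≠ 0 → x ≠ 0 → T x = μ • x → μ ∈ Set.Icc a b) (x : E) :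
    a * (inner ℝ x x - inner ℝ e x ^ 2 / inner ℝ e e) ≤ inner ℝ x (T x) ∧
      inner ℝ x (T x) ≤ b * (inner ℝ x x - inner ℝ e x ^ 2 / inner ℝ e e) := by
  have hee : inner ℝ e e ≠ 0 := by rwa [Ne, inner_self_eq_zero]
  -- The component of `x` orthogonal to the kernel; neither the form nor the distance to the line of
  -- `e` changes.
  set y := x - (inner ℝ e x / inner ℝ e e) • e with hy
  have hey : inner ℝ e y = 0 := by
    rw [hy, inner_sub_right, real_inner_smul_right]
    field_simp
    ring
  have hyy : inner ℝ x x - inner ℝ e x ^ 2 / inner ℝ e e = inner ℝ y y := by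
    have h1 : inner ℝ y y = inner ℝ (x - (inner ℝ e x / inner ℝ e e) • e) y := by rw [← hy]
    rw [h1, inner_sub_left, real_inner_smul_left, hey, hy, inner_sub_right,
      real_inner_smul_right, real_inner_comm e x]
    ring
  have hTy : inner ℝ x (T x) = inner ℝ y (T y) := by
    have h1 : T y = T x := by rw [hy, map_sub, map_smul, hTe, smul_zero, sub_zero]
    rw [h1, hy, inner_sub_left, real_inner_smul_left, ← hT e x, hTe]
    simp
  rw [hyy, hTy, hT.inner_apply_self_eq_sum,
    ← (hT.eigenvectorBasis rfl).sum_inner_mul_inner, Finset.mul_sum, Finset.mul_sum]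
  -- An eigenvector with eigenvalue zero is a multiple of `e`, hence orthogonal to `y`, and drops
  -- out of the expansion.
  have key : ∀ i, hT.eigenvalues rfl i ∈ Set.Icc a b ∨
      inner ℝ (hT.eigenvectorBasis rfl i) y = 0 := by
    intro i
    have h1 := hT.apply_eigenvectorBasis rfl i
    by_cases h0 : hT.eigenvalues rfl i = 0
    · right
      obtain ⟨c, hc⟩ := hker _ (by rw [h1, h0]; simp)
      rw [hc, real_inner_smul_left, hey, mul_zero]
    · left
      exact hev _ _ h0 ((hT.eigenvectorBasis rfl).orthonormal.ne_zero i) h1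
  constructor <;> refine Finset.sum_le_sum fun i _ => ?_ <;>
    rw [real_inner_comm _ y, ← sq] <;> rcases key i with h | h
  · exact mul_le_mul_of_nonneg_right h.1 (sq_nonneg _)
  · simp [h]
  · exact mul_le_mul_of_nonneg_right h.2 (sq_nonneg _)
  · simp [h]

end Symmetric

/-! ### Links computed inside the ambient complex -/

namespace WeightedComplex

variable {V : Type*} [Fintype V] [DecidableEq V]

theorem inner_upperLaplacian {X : WeightedComplex V} {k : ℕ} (φ ψ : X.Form (k + 1)) :
    inner ℝ φ (X.upperLaplacian k ψ) = inner ℝ (X.d (k + 1) φ) (X.d (k + 1) ψ) := by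
  rw [upperLaplacian, LinearMap.comp_apply, codiff, LinearMap.adjoint_inner_right]

theorem inner_lowerLaplacian {X : WeightedComplex V} {k : ℕ} (φ ψ : X.Form (k + 1)) :
    inner ℝ φ (X.lowerLaplacian k ψ) = inner ℝ (X.codiff k φ) (X.codiff k ψ) := by
  rw [lowerLaplacian, LinearMap.comp_apply, codiff, LinearMap.adjoint_inner_left]

theorem isSymmetric_upperLaplacian (X : WeightedComplex V) (k : ℕ) :
    (X.upperLaplacian k).IsSymmetric := fun φ ψ => by
  rw [inner_upperLaplacian, real_inner_comm, inner_upperLaplacian, real_inner_comm]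

theorem isSymmetric_lowerLaplacian (X : WeightedComplex V) (k : ℕ) :
    (X.lowerLaplacian k).IsSymmetric := fun φ ψ => by
  rw [inner_lowerLaplacian, real_inner_comm, inner_lowerLaplacian, real_inner_comm]

section Links

variable {X : WeightedComplex V} {k : ℕ} {τ : Fin k → V}

theorem mem_link_simplices {T s : Finset V} (hT : T ∈ X.simplices) :
    s ∈ (X.link T hT).simplices ↔ Disjoint T s ∧ T ∪ s ∈ X.simplices := by
  rw [mem_simplices]
  rcases s.eq_empty_or_nonempty with rfl | hs
  · simpa using hT
  · have h1 : T ∪ s ≠ ∅ := (hs.mono Finset.subset_union_right).ne_empty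
    have h2 : s ∈ (X.link T hT).faces ↔ s.Nonempty ∧ Disjoint T s ∧ T ∪ s ∈ X.faces := Iff.rfl
    rw [h2, mem_simplices]
    simp [hs, hs.ne_empty, h1]

/-- Link weights are ambient weights of the joined tuple `ρ`, so calculations in a link become sums
over `Fin.cons` in `X`. -/
theorem tupleWeight_link {i j : ℕ} (hτ : X.IsOrdered τ) {σ : Fin j → V} {ρ : Fin i → V}
    (hinj : Function.Injective ρ ↔
      Function.Injective σ ∧ Disjoint (Finset.univ.image τ) (Finset.univ.image σ))
    (himg : Finset.univ.image ρ = Finset.univ.image τ ∪ Finset.univ.image σ) :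
    (X.link _ hτ.2).tupleWeight σ = X.tupleWeight ρ := by
  have h : (X.link _ hτ.2).IsOrdered σ ↔ X.IsOrdered ρ := by
    rw [IsOrdered, IsOrdered, mem_link_simplices, hinj, himg, and_assoc]
  by_cases hρ : X.IsOrdered ρ
  · rw [tupleWeight_of_isOrdered hρ, tupleWeight_of_isOrdered (h.2 hρ), himg]
    rfl
  · rw [tupleWeight_of_not hρ, tupleWeight_of_not (mt h.1 hρ)]

theorem tupleWeight_link_cons (hτ : X.IsOrdered τ) (v : V) (ε : Fin 0 → V) :
    (X.link _ hτ.2).tupleWeight (Fin.cons v ε : Fin 1 → V) =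
      X.tupleWeight (Fin.cons v τ : Fin (k + 1) → V) := by
  refine tupleWeight_link hτ ?_ ?_
  · rw [Fin.cons_injective_iff, image_cons]
    have : Function.Injective (Fin.cons v ε : Fin 1 → V) :=
      fun x y _ => Subsingleton.elim (α := Fin 1) x y
    simp [hτ.1, this]
  · simp only [image_cons]
    ext x
    simp

theorem tupleWeight_link_cons_cons (hτ : X.IsOrdered τ) (u v : V) (ε : Fin 0 → V) :
    (X.link _ hτ.2).tupleWeight (Fin.cons u (Fin.cons v ε) : Fin 2 → V) =
      X.tupleWeight (Fin.cons u (Fin.cons v τ) : Fin (k + 2) → V) := by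
  refine tupleWeight_link hτ ?_ ?_
  · simp only [image_cons, Fin.cons_injective_iff]
    have : Function.Injective ε := Function.injective_of_subsingleton _
    simp [hτ.1, this, and_assoc]
  · simp only [image_cons]
    ext x
    simp

/-- The `0`-form given by a function on the vertices. -/
noncomputable def vertexForm (Y : WeightedComplex V) (g : V → ℝ) : Y.Form 1 :=
  ⟨fun σ => g (σ.1 0), fun σ π => by
    rw [Subsingleton.elim π 1]
    change g (σ.1 0) = _
    simp⟩

theorem tupleWeight_mul_extend_vertexForm (Y : WeightedComplex V) (g : V → ℝ) (v : V)
    (ε : Fin 0 → V) :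
    Y.tupleWeight (Fin.cons v ε : Fin 1 → V) * extend (Y.vertexForm g) (Fin.cons v ε) =
      Y.tupleWeight (Fin.cons v ε : Fin 1 → V) * g v := by
  by_cases h : Y.IsOrdered (Fin.cons v ε : Fin 1 → V)
  · rw [extend_of_isOrdered _ h]
    rfl
  · rw [tupleWeight_of_not h, zero_mul, zero_mul]

theorem exists_eq_vertexForm {Y : WeightedComplex V} (φ : Y.Form 1) :
    ∃ g, φ = Y.vertexForm g := by
  refine ⟨fun v => extend φ (fun _ => v), form_ext fun σ hσ => ?_⟩
  rw [extend_of_isOrdered (Y.vertexForm _) hσ]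
  change _ = extend φ (fun _ => σ 0)
  exact congrArg _ (funext fun x => by rw [Subsingleton.elim x 0])

theorem inner_vertexForm (hτ : X.IsOrdered τ) (g h : V → ℝ) :
    inner ℝ ((X.link _ hτ.2).vertexForm g) ((X.link _ hτ.2).vertexForm h) =
      ∑ v, X.tupleWeight (Fin.cons v τ : Fin (k + 1) → V) * g v * h v := by
  rw [inner_eq_sum, sum_tuple_succ, Fintype.sum_unique (ι := Fin 0 → V)]
  simp only [Nat.factorial_one, Nat.cast_one, div_one, one_mul]
  refine Finset.sum_congr rfl fun v _ => ?_
  rw [tupleWeight_mul_extend_vertexForm, mul_right_comm, tupleWeight_mul_extend_vertexForm,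
    tupleWeight_link_cons hτ]
  ring

theorem inner_d_vertexForm (hτ : X.IsOrdered τ)
    (hbal : ∀ v, ∑ u, X.tupleWeight (Fin.cons u (Fin.cons v τ) : Fin (k + 2) → V) =
      X.tupleWeight (Fin.cons v τ : Fin (k + 1) → V)) (g h : V → ℝ) :
    inner ℝ ((X.link _ hτ.2).d 1 ((X.link _ hτ.2).vertexForm g))
        ((X.link _ hτ.2).d 1 ((X.link _ hτ.2).vertexForm h)) =
      ∑ v, X.tupleWeight (Fin.cons v τ : Fin (k + 1) → V) * g v * h v -
        ∑ u, ∑ v, X.tupleWeight (Fin.cons v (Fin.cons u τ) : Fin (k + 2) → V) * g v * h u := by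
  rw [inner_d_d, inner_vertexForm hτ, Fintype.sum_unique (ι := Fin 0 → V)]
  · simp only [Nat.factorial_zero, Nat.cast_one, div_one, one_mul]
    refine congrArg _ (Finset.sum_congr rfl fun u _ => Finset.sum_congr rfl fun v _ => ?_)
    rw [← tupleWeight_link_cons_cons hτ v u default]
    by_cases h0 : (X.link _ hτ.2).IsOrdered
        (Fin.cons v (Fin.cons u (default : Fin 0 → V)) : Fin 2 → V)
    · have h1 := h0.tail
      -- The pair weight is symmetric and positive, so swapping the pair shows that `v` is also a
      -- vertex of the link.
      have h2 : (X.link _ hτ.2).IsOrdered (Fin.cons v (default : Fin 0 → V) : Fin 1 → V) := by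
        have := tupleWeight_pos h0
        rw [tupleWeight_cons_cons_comm] at this
        by_contra h3
        rw [tupleWeight_cons_eq_zero h3] at this
        exact this.false
      rw [extend_of_isOrdered _ h1, extend_of_isOrdered _ h2]
      rfl
    · simp [tupleWeight_of_not h0]
  · intro σ
    obtain ⟨v, ε, rfl⟩ : ∃ v ε, σ = (Fin.cons v ε : Fin 1 → V) :=
      ⟨σ 0, Fin.tail σ, (Fin.cons_self_tail σ).symm⟩
    rw [tupleWeight_link_cons hτ, ← hbal]
    exact Finset.sum_congr rfl fun u _ => tupleWeight_link_cons_cons hτ u v ε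

end Links

/-! ### Local spectral gaps and Garland's descent -/

/-- The energy of a function on the vertices of the link of `τ`. -/
noncomputable def localEnergy (X : WeightedComplex V) {k : ℕ} (τ : Fin k → V) (g : V → ℝ) : ℝ :=
  ∑ v, X.tupleWeight (Fin.cons v τ : Fin (k + 1) → V) * g v ^ 2 -
    ∑ u, ∑ v, X.tupleWeight (Fin.cons v (Fin.cons u τ) : Fin (k + 2) → V) * g v * g u

/-- The variance of a function on the vertices of the link of `τ`. -/
noncomputable def localVariance (X : WeightedComplex V) {k : ℕ} (τ : Fin k → V) (g : V → ℝ) : ℝ :=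
  ∑ v, X.tupleWeight (Fin.cons v τ : Fin (k + 1) → V) * g v ^ 2 -
    (∑ v, X.tupleWeight (Fin.cons v τ : Fin (k + 1) → V) * g v) ^ 2 / X.tupleWeight τ

/-- The nonconstant spectrum of the links of all simplices with `k` vertices lies in `[a, b]`,
in terms of quadratic forms. -/
def LocalGap (X : WeightedComplex V) (k : ℕ) (a b : ℝ) : Prop :=
  ∀ τ : Fin k → V, X.IsOrdered τ → ∀ g : V → ℝ,
    a * X.localVariance τ g ≤ X.localEnergy τ g ∧ X.localEnergy τ g ≤ b * X.localVariance τ g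

section Gap

variable {X : WeightedComplex V} {k n : ℕ} {τ : Fin k → V}

theorem inner_upperLaplacian_vertexForm (hbal : X.IsBalanced n) (hk : k < n)
    (hτ : X.IsOrdered τ) (g : V → ℝ) :
    inner ℝ ((X.link _ hτ.2).vertexForm g)
      ((X.link _ hτ.2).upperLaplacian 0 ((X.link _ hτ.2).vertexForm g)) =
        X.localEnergy τ g := by
  rw [inner_upperLaplacian, inner_d_vertexForm hτ
    (fun v => hbal.sum_tupleWeight_cons (j := k + 1) hk _), localEnergy]
  simp only [sq, mul_assoc]

/-- Balance splits each vertex weight over edges and completes the square. The Dirichlet form makes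
the energy visibly nonnegative and zero on constants. -/
theorem localEnergy_eq (hbal : X.IsBalanced n) (hk : k < n) (g : V → ℝ) :
    2 * X.localEnergy τ g = ∑ u, ∑ v,
      X.tupleWeight (Fin.cons v (Fin.cons u τ) : Fin (k + 2) → V) * (g v - g u) ^ 2 := by
  have h1 : ∑ u, ∑ v, X.tupleWeight (Fin.cons v (Fin.cons u τ) : Fin (k + 2) → V) * g u ^ 2 =
      ∑ v, X.tupleWeight (Fin.cons v τ : Fin (k + 1) → V) * g v ^ 2 :=
    Finset.sum_congr rfl fun u _ => by
      rw [← Finset.sum_mul, hbal.sum_tupleWeight_cons (j := k + 1) hk]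
  have h2 : ∑ u, ∑ v, X.tupleWeight (Fin.cons v (Fin.cons u τ) : Fin (k + 2) → V) * g v ^ 2 =
      ∑ v, X.tupleWeight (Fin.cons v τ : Fin (k + 1) → V) * g v ^ 2 := by
    rw [Finset.sum_comm, ← h1]
    exact Finset.sum_congr rfl fun u _ => Finset.sum_congr rfl fun v _ => by
      rw [tupleWeight_cons_cons_comm]
  have h3 : ∀ u v, X.tupleWeight (Fin.cons v (Fin.cons u τ) : Fin (k + 2) → V) *
      (g v - g u) ^ 2 =
      X.tupleWeight (Fin.cons v (Fin.cons u τ) : Fin (k + 2) → V) * g v ^ 2 +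
      X.tupleWeight (Fin.cons v (Fin.cons u τ) : Fin (k + 2) → V) * g u ^ 2 -
      2 * (X.tupleWeight (Fin.cons v (Fin.cons u τ) : Fin (k + 2) → V) * g v * g u) := by
    intro u v; ring
  simp_rw [h3, Finset.sum_sub_distrib, Finset.sum_add_distrib, ← Finset.mul_sum]
  rw [h1, h2, localEnergy]
  ring

/-- Every squared difference vanishes, so `g` agrees across each edge, and connectedness propagates
this along walks. -/
theorem eq_const_of_localEnergy_eq_zero (hbal : X.IsBalanced n) (hk : k < n)
    (hτ : X.IsOrdered τ) (hconn : (X.link _ hτ.2).oneSkeleton.Connected) {g : V → ℝ}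
    (hg : X.localEnergy τ g = 0) :
    ∃ c : ℝ, (X.link _ hτ.2).vertexForm g = c • (X.link _ hτ.2).vertexForm 1 := by
  have h0 := localEnergy_eq (τ := τ) hbal hk g
  rw [hg, mul_zero, eq_comm, Finset.sum_eq_zero_iff_of_nonneg fun u _ => Finset.sum_nonneg
    fun v _ => mul_nonneg (tupleWeight_nonneg _) (sq_nonneg _)] at h0
  have hadj : ∀ u v, (X.link _ hτ.2).oneSkeleton.Adj u v → g u.1 = g v.1 := by
    rintro ⟨u, hu⟩ ⟨v, hv⟩ ⟨h1, h2⟩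
    have h3 := (Finset.sum_eq_zero_iff_of_nonneg fun v _ =>
      mul_nonneg (tupleWeight_nonneg _) (sq_nonneg _)).1 (h0 v (Finset.mem_univ _)) u
        (Finset.mem_univ _)
    have h4 : 0 < X.tupleWeight (Fin.cons u (Fin.cons v τ) : Fin (k + 2) → V) := by
      rw [← tupleWeight_link_cons_cons hτ u v default]
      refine tupleWeight_pos ⟨?_, ?_⟩
      · simp only [Fin.cons_injective_iff]
        refine ⟨?_, ?_, Function.injective_of_subsingleton _⟩
        · simpa [Subtype.ext_iff, eq_comm] using h1
        · simp
      · rw [image_cons, image_cons]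
        simpa using h2
    have h5 := (mul_eq_zero.1 h3).resolve_left h4.ne'
    exact sub_eq_zero.1 (pow_eq_zero_iff two_ne_zero |>.1 h5)
  have hreach : ∀ u v, (X.link _ hτ.2).oneSkeleton.Reachable u v → g u.1 = g v.1 := by
    rintro u v ⟨p⟩
    induction p with
    | nil => rfl
    | cons h _ ih => exact (hadj _ _ h).trans ih
  obtain ⟨v₀⟩ := hconn.nonempty
  refine ⟨g v₀.1, form_ext fun σ hσ => ?_⟩
  rw [extend_smul, extend_of_isOrdered _ hσ, extend_of_isOrdered _ hσ]
  change g (σ 0) = g v₀.1 * 1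
  have hσ0 : {σ 0} ∈ (X.link _ hτ.2).simplices := by
    have := hσ.2
    simpa using this
  rw [mul_one]
  exact hreach ⟨σ 0, hσ0⟩ v₀ (hconn.preconnected _ _)

/-- Connectedness makes the kernel exactly the constants. Since `⟨1, 1⟩ = m(τ)`, the variance is the
squared distance to them, and the spectral pinching applies. -/
theorem localGap_of_eigenvalues (hbal : X.IsBalanced n) (hk : k < n)
    (hconn : ∀ (T : Finset V) (hT : T ∈ X.simplices), T.card < n →
      (X.link T hT).oneSkeleton.Connected) {a b : ℝ}
    (hev : ∀ (τ : Fin k → V) (hτ : X.IsOrdered τ) (μ : ℝ) (g : V → ℝ), μ ≠ 0 →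
      (X.link _ hτ.2).vertexForm g ≠ 0 →
      (X.link _ hτ.2).upperLaplacian 0 ((X.link _ hτ.2).vertexForm g) =
        μ • (X.link _ hτ.2).vertexForm g → μ ∈ Set.Icc a b) :
    X.LocalGap k a b := by
  intro τ hτ g
  have hcard : (Finset.univ.image τ).card < n := by
    rwa [Finset.card_image_of_injective _ hτ.1, Finset.card_univ, Fintype.card_fin]
  have hone : inner ℝ ((X.link _ hτ.2).vertexForm 1) ((X.link _ hτ.2).vertexForm 1) =
      X.tupleWeight τ := by
    rw [inner_vertexForm hτ, ← hbal.sum_tupleWeight_cons hk.le]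
    simp
  have hzero : ∀ φ : (X.link _ hτ.2).Form 1, (X.link _ hτ.2).upperLaplacian 0 φ = 0 →
      ∃ c : ℝ, φ = c • (X.link _ hτ.2).vertexForm 1 := by
    intro φ hφ
    obtain ⟨h, rfl⟩ := exists_eq_vertexForm φ
    refine eq_const_of_localEnergy_eq_zero hbal hk hτ (hconn _ _ hcard) ?_
    rw [← inner_upperLaplacian_vertexForm hbal hk hτ, hφ, inner_zero_right]
  have hconst : (X.link _ hτ.2).upperLaplacian 0 ((X.link _ hτ.2).vertexForm 1) = 0 := by
    have h1 : (X.link _ hτ.2).d 1 ((X.link _ hτ.2).vertexForm 1) = 0 := by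
      rw [← inner_self_eq_zero (𝕜 := ℝ), ← inner_upperLaplacian,
        inner_upperLaplacian_vertexForm hbal hk hτ]
      have := localEnergy_eq (τ := τ) hbal hk 1
      simpa using this
    rw [upperLaplacian, LinearMap.comp_apply, h1, map_zero]
  have hmain := ((X.link _ hτ.2).isSymmetric_upperLaplacian 0).inner_apply_self_mem_Icc
    (e := (X.link _ hτ.2).vertexForm 1) (a := a) (b := b)
    (by
      intro h
      rw [h, inner_zero_left] at hone
      exact (tupleWeight_pos hτ).ne hone)
    hconst hzero
    (by
      intro μ φ hμ hφ h
      obtain ⟨g, rfl⟩ := exists_eq_vertexForm φ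
      exact hev τ hτ μ g hμ hφ h)
    ((X.link _ hτ.2).vertexForm g)
  rw [inner_upperLaplacian_vertexForm hbal hk hτ, hone, inner_vertexForm hτ, inner_vertexForm hτ] at hmain
  have hvar : X.localVariance τ g =
      ∑ v, X.tupleWeight (Fin.cons v τ : Fin (k + 1) → V) * g v * g v -
      (∑ v, X.tupleWeight (Fin.cons v τ : Fin (k + 1) → V) * (1 : V → ℝ) v * g v) ^ 2 /
        X.tupleWeight τ := by
    simp only [localVariance, Pi.one_apply, mul_one, sq, mul_assoc]
  rwa [← hvar] at hmain

/-- Pair the eigenvalue equation with the indicator of `v`. -/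
theorem sum_link_eq_of_eigenvector (hbal : X.IsBalanced n) (hk : k < n) (hτ : X.IsOrdered τ)
    {μ : ℝ} {g : V → ℝ}
    (h : (X.link _ hτ.2).upperLaplacian 0 ((X.link _ hτ.2).vertexForm g) =
      μ • (X.link _ hτ.2).vertexForm g) (v : V) :
    ∑ u, X.tupleWeight (Fin.cons u (Fin.cons v τ) : Fin (k + 2) → V) * g u =
      (1 - μ) * (X.tupleWeight (Fin.cons v τ : Fin (k + 1) → V) * g v) := by
  have h1 := congrArg (fun φ => inner ℝ φ ((X.link _ hτ.2).vertexForm (Pi.single v 1))) h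
  rw [real_inner_comm, inner_upperLaplacian, real_inner_comm, inner_d_vertexForm hτ
    (fun v => hbal.sum_tupleWeight_cons (j := k + 1) hk _), real_inner_smul_left,
    inner_vertexForm hτ] at h1
  simp only [Pi.single_apply, mul_ite, mul_one, mul_zero, Finset.sum_ite_eq', Finset.mem_univ,
    if_true] at h1
  rw [Finset.sum_comm] at h1
  simp only [Finset.sum_ite_eq', Finset.mem_univ, if_true] at h1
  linarith

/-- Garland's descent: a spectral gap in the links of the simplices with `k + 1` vertices gives
one in the links of the simplices with `k` vertices. -/
theorem LocalGap.descend (hbal : X.IsBalanced n) (hk : k + 1 < n)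
    (hconn : ∀ (T : Finset V) (hT : T ∈ X.simplices), T.card < n →
      (X.link T hT).oneSkeleton.Connected) {a b : ℝ} (ha : 0 < a) (hb : 0 < b)
    (hgap : X.LocalGap (k + 1) a b) : X.LocalGap k (descentMap a) (descentMap b) := by
  have hk' : k < n := by omega
  refine localGap_of_eigenvalues hbal hk' hconn fun τ hτ μ g hμ hg heig => ?_
  set N := ∑ v, X.tupleWeight (Fin.cons v τ : Fin (k + 1) → V) * g v ^ 2 with hN
  have hNpos : 0 < N := by
    have h1 : N = inner ℝ ((X.link _ hτ.2).vertexForm g) ((X.link _ hτ.2).vertexForm g) := by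
      rw [inner_vertexForm hτ]
      simp only [hN, sq, mul_assoc]
    rw [h1]
    exact real_inner_self_pos.2 hg
  have hE : X.localEnergy τ g = μ * N := by
    rw [← inner_upperLaplacian_vertexForm hbal hk' hτ, heig, real_inner_smul_right,
      inner_vertexForm hτ]
    simp only [hN, sq, mul_assoc]
  have hμpos : 0 < μ := by
    have h1 : 0 ≤ 2 * X.localEnergy τ g := by
      rw [localEnergy_eq hbal hk']
      exact Finset.sum_nonneg fun u _ => Finset.sum_nonneg
        fun v _ => mul_nonneg (tupleWeight_nonneg _) (sq_nonneg _)
    rw [hE] at h1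
    have h2 : 0 ≤ μ := by
      by_contra! h3
      nlinarith
    exact lt_of_le_of_ne h2 hμ.symm
  have hsum1 : ∑ w, ∑ v, X.tupleWeight (Fin.cons v (Fin.cons w τ) : Fin (k + 2) → V) * g v ^ 2
      = N := by
    rw [Finset.sum_comm, hN]
    refine Finset.sum_congr rfl fun v _ => ?_
    rw [← Finset.sum_mul, ← hbal.sum_tupleWeight_cons (j := k + 1) hk']
    exact congrArg (· * _) (Finset.sum_congr rfl fun w _ => tupleWeight_cons_cons_comm _ _ _)
  -- Energy localizes exactly: summing `m(v, u, w, τ)` over `w` gives `m(v, u, τ)` by balance, once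
  -- `w` is moved past `u` and `v`.
  have hsum2 : ∑ w, X.localEnergy (Fin.cons w τ : Fin (k + 1) → V) g = μ * N := by
    rw [← hE]
    simp only [localEnergy]
    rw [Finset.sum_sub_distrib, hsum1, hN]
    congr 1
    rw [Finset.sum_comm]
    refine Finset.sum_congr rfl fun u _ => ?_
    rw [Finset.sum_comm]
    refine Finset.sum_congr rfl fun v _ => ?_
    rw [← hbal.sum_tupleWeight_cons (j := k + 2) hk, Finset.sum_mul, Finset.sum_mul]
    refine Finset.sum_congr rfl fun w _ => ?_
    rw [tupleWeight_cons_cons_comm w v]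
    have := tupleWeight_cons_comp_perm (X := X) v
      (Fin.cons u (Fin.cons w τ) : Fin (k + 2) → V) (Equiv.swap 0 1)
    rw [← this]
    congr 4
    funext x
    refine Fin.cases ?_ (fun x => ?_) x
    · simp
    · refine Fin.cases ?_ (fun x => ?_) x
      · simp
      · rw [Function.comp_apply, Equiv.swap_apply_of_ne_of_ne]
        · simp
        · exact Fin.succ_ne_zero _
        · rw [← Fin.succ_zero_eq_one, Ne, Fin.succ_inj]
          exact Fin.succ_ne_zero _
  -- By the eigenvalue equation the mean of `g` over the link of `(w, τ)` is `(1 - μ) g(w)`, so the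
  -- squared means total `(1 - μ)² N`, and `1 - (1 - μ)² = μ(2 - μ)`.
  have hsum3 : ∑ w, X.localVariance (Fin.cons w τ : Fin (k + 1) → V) g = μ * (2 - μ) * N := by
    simp only [localVariance]
    rw [Finset.sum_sub_distrib, hsum1]
    have h1 : ∀ w, (∑ v, X.tupleWeight (Fin.cons v (Fin.cons w τ) : Fin (k + 2) → V) * g v) ^ 2 /
        X.tupleWeight (Fin.cons w τ : Fin (k + 1) → V) =
        (1 - μ) ^ 2 * (X.tupleWeight (Fin.cons w τ : Fin (k + 1) → V) * g w ^ 2) := by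
      intro w
      rw [sum_link_eq_of_eigenvector hbal hk' hτ heig]
      by_cases h0 : X.tupleWeight (Fin.cons w τ : Fin (k + 1) → V) = 0
      · simp [h0]
      · field_simp
    rw [Finset.sum_congr rfl fun w _ => h1 w, ← Finset.mul_sum, ← hN]
    ring
  have hloc : ∀ w, a * X.localVariance (Fin.cons w τ : Fin (k + 1) → V) g ≤
      X.localEnergy (Fin.cons w τ : Fin (k + 1) → V) g ∧
      X.localEnergy (Fin.cons w τ : Fin (k + 1) → V) g ≤
        b * X.localVariance (Fin.cons w τ : Fin (k + 1) → V) g := by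
    intro w
    by_cases h : X.IsOrdered (Fin.cons w τ : Fin (k + 1) → V)
    · exact hgap _ h g
    · have h1 := tupleWeight_cons_eq_zero h
      have h2 : ∀ u v, X.tupleWeight
          (Fin.cons v (Fin.cons u (Fin.cons w τ)) : Fin (k + 3) → V) = 0 :=
        fun u v => tupleWeight_of_not fun h' => h h'.tail.tail
      simp [localVariance, localEnergy, h1, h2]
  have hlow : a * (μ * (2 - μ) * N) ≤ μ * N := by
    rw [← hsum3, ← hsum2, Finset.mul_sum]
    exact Finset.sum_le_sum fun w _ => (hloc w).1
  have hupp : μ * N ≤ b * (μ * (2 - μ) * N) := by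
    rw [← hsum3, ← hsum2, Finset.mul_sum]
    exact Finset.sum_le_sum fun w _ => (hloc w).2
  -- Dividing both inequalities by this positive number leaves conditions on `2 - μ` alone.
  have hμN : 0 < μ * N := mul_pos hμpos hNpos
  have h1 : a * (2 - μ) ≤ 1 := by
    by_contra! h
    nlinarith
  have h2 : 1 ≤ b * (2 - μ) := by
    by_contra! h
    nlinarith
  constructor
  · have : 2 - μ ≤ 1 / a := by rw [le_div_iff₀ ha]; linarith
    rw [descentMap]; linarith
  · have : 1 / b ≤ 2 - μ := by rw [div_le_iff₀ hb]; linarith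
    rw [descentMap]; linarith

/-- The quadratic form of the Laplacians is pinched by the spectral gap of the links. -/
theorem LocalGap.inner_bounds (hbal : X.IsBalanced n) (hk : k < n) {a b : ℝ}
    (hgap : X.LocalGap k a b) (hab : a ≤ b) (φ : X.Form (k + 1)) :
    |inner ℝ φ ((X.upperLaplacian k + ((a + b) / 2) • X.lowerLaplacian k -
      (((k : ℝ) + 1) * ((a + b) / 2 - (k : ℝ) / ((k : ℝ) + 1))) •
        (1 : Module.End ℝ (X.Form (k + 1)))) φ)| ≤
      ((k : ℝ) + 1) / 2 * (b - a) * inner ℝ φ φ := by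
  set A := ∑ τ : Fin k → V, ∑ v, X.tupleWeight (Fin.cons v τ : Fin (k + 1) → V) *
    extend φ (Fin.cons v τ) ^ 2 with hA
  set B := ∑ τ : Fin k → V, ∑ u, ∑ v,
    X.tupleWeight (Fin.cons v (Fin.cons u τ) : Fin (k + 2) → V) *
      extend φ (Fin.cons v τ) * extend φ (Fin.cons u τ) with hB
  set D := ∑ τ : Fin k → V, (∑ v, X.tupleWeight (Fin.cons v τ : Fin (k + 1) → V) *
    extend φ (Fin.cons v τ)) ^ 2 / X.tupleWeight τ with hD
  have hfac : (0 : ℝ) < k.factorial := Nat.cast_pos.2 k.factorial_pos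
  have hkpos : (0 : ℝ) < (k : ℝ) + 1 := by positivity
  have hinner : inner ℝ φ φ = A / ((k + 1) * k.factorial) := by
    rw [inner_eq_sum, sum_tuple_succ, Nat.factorial_succ, hA]
    push_cast
    simp only [sq, mul_assoc]
    ring
  have hupper : inner ℝ φ (X.upperLaplacian k φ) =
      A / ((k + 1) * k.factorial) - B / k.factorial := by
    rw [inner_upperLaplacian, inner_d_d (fun τ => hbal.sum_tupleWeight_cons (j := k + 1) hk τ),
      hinner]
    ring
  have hlower : inner ℝ φ (X.lowerLaplacian k φ) = D / k.factorial := by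
    rw [inner_lowerLaplacian, norm_codiff_sq]
    ring
  have hD0 : 0 ≤ D := Finset.sum_nonneg fun τ _ =>
    div_nonneg (sq_nonneg _) (tupleWeight_nonneg _)
  have hloc : ∀ τ : Fin k → V,
      a * X.localVariance τ (fun v => extend φ (Fin.cons v τ)) ≤
        X.localEnergy τ (fun v => extend φ (Fin.cons v τ)) ∧
      X.localEnergy τ (fun v => extend φ (Fin.cons v τ)) ≤
        b * X.localVariance τ (fun v => extend φ (Fin.cons v τ)) := by
    intro τ
    by_cases h : X.IsOrdered τ
    · exact hgap τ h _
    · have h1 := tupleWeight_cons_eq_zero h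
      have h2 : ∀ u v, X.tupleWeight (Fin.cons v (Fin.cons u τ) : Fin (k + 2) → V) = 0 :=
        fun u v => tupleWeight_of_not fun h' => h h'.tail.tail
      simp [localVariance, localEnergy, h1, h2]
  have hvar : ∑ τ : Fin k → V, X.localVariance τ (fun v => extend φ (Fin.cons v τ)) = A - D := by
    simp only [localVariance, Finset.sum_sub_distrib, hA, hD]
  have hen : ∑ τ : Fin k → V, X.localEnergy τ (fun v => extend φ (Fin.cons v τ)) = A - B := by
    simp only [localEnergy, Finset.sum_sub_distrib, hA, hB]
  have hlow : a * (A - D) ≤ A - B := by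
    rw [← hvar, ← hen, Finset.mul_sum]
    exact Finset.sum_le_sum fun τ _ => (hloc τ).1
  have hupp : A - B ≤ b * (A - D) := by
    rw [← hvar, ← hen, Finset.mul_sum]
    exact Finset.sum_le_sum fun τ _ => (hloc τ).2
  -- The multiple of the identity equals `(k + 1)c - k` with `c = (a + b)/2`: it completes `A/(k+1)`
  -- to `A` and turns `cD` into `-c(A - D)`.
  have hform : inner ℝ φ ((X.upperLaplacian k + ((a + b) / 2) • X.lowerLaplacian k -
      (((k : ℝ) + 1) * ((a + b) / 2 - (k : ℝ) / ((k : ℝ) + 1))) •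
        (1 : Module.End ℝ (X.Form (k + 1)))) φ) =
      (A - B - (a + b) / 2 * (A - D)) / k.factorial := by
    rw [LinearMap.sub_apply, LinearMap.add_apply, LinearMap.smul_apply, LinearMap.smul_apply,
      Module.End.one_apply, inner_sub_right, inner_add_right, real_inner_smul_right,
      real_inner_smul_right, hinner, hupper, hlower]
    field_simp
    ring
  have hrhs : ((k : ℝ) + 1) / 2 * (b - a) * inner ℝ φ φ = ((b - a) / 2 * A) / k.factorial := by
    rw [hinner]
    field_simp
  rw [hform, hrhs, abs_div, abs_of_pos hfac]
  refine div_le_div_of_nonneg_right ?_ hfac.le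
  rw [abs_le]
  -- The local bounds give `(b - a)/2 · (A - D)`; this allows `D` to be discarded.
  have := mul_nonneg (sub_nonneg.2 hab) hD0
  constructor <;> nlinarith

end Gap

end WeightedComplex

/-! ### Iterates of the descent map -/

theorem descentMap_mono {a b : ℝ} (ha : 0 < a) (hab : a ≤ b) : descentMap a ≤ descentMap b := by
  have := one_div_le_one_div_of_le ha hab
  rw [descentMap, descentMap]
  linarith

/-- Since `f((m - 1)/m) = (m - 2)/(m - 1)`, the threshold `(n - 1)/n` moves one step down this
sequence at each iteration. It thus keeps every iterate to which `f` is applied positive, where `f`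
is increasing. -/
theorem lt_descentMap_iterate {n : ℕ} {a : ℝ} (ha : ((n : ℝ) - 1) / n < a) {j : ℕ} (hj : j < n) :
    ((n : ℝ) - 1 - j) / (n - j) < descentMap^[j] a := by
  induction j with
  | zero => simpa using ha
  | succ j ih =>
    have h1 := ih (by omega)
    rw [Function.iterate_succ_apply']
    have hn : (j : ℝ) + 1 + 1 ≤ n := by exact_mod_cast hj
    have h2 : 0 < ((n : ℝ) - 1 - j) / (n - j) := div_pos (by linarith) (by linarith)
    have h3 := one_div_lt_one_div_of_lt h2 h1
    rw [one_div_div] at h3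
    have h4 : ((n : ℝ) - 1 - ((j + 1 : ℕ) : ℝ)) / (n - ((j + 1 : ℕ) : ℝ)) =
        2 - ((n : ℝ) - j) / (n - 1 - j) := by
      have h5 : (n : ℝ) - 1 - j ≠ 0 := by linarith
      have h6 : (n : ℝ) - (j + 1) ≠ 0 := by intro h; apply h5; linarith
      push_cast
      field_simp
      ring
    rw [h4, descentMap]
    linarith

theorem descentMap_iterate_pos {n : ℕ} {a : ℝ} (ha : ((n : ℝ) - 1) / n < a) {j : ℕ}
    (hj : j + 1 < n) : 0 < descentMap^[j] a := by
  refine lt_trans ?_ (lt_descentMap_iterate ha (by omega : j < n))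
  have hn : (j : ℝ) + 1 + 1 ≤ n := by exact_mod_cast hj
  exact div_pos (by linarith) (by linarith)

theorem descentMap_iterate_mono {n : ℕ} {a b : ℝ} (ha : ((n : ℝ) - 1) / n < a) (hab : a ≤ b)
    {j : ℕ} (hj : j < n) : descentMap^[j] a ≤ descentMap^[j] b := by
  induction j with
  | zero => exact hab
  | succ j ih =>
    rw [Function.iterate_succ_apply', Function.iterate_succ_apply']
    exact descentMap_mono (descentMap_iterate_pos ha hj) (ih (by omega))

/-! ### From the codimension-two links to the norm bound -/

theorem WeightedComplex.localGap_iterate {V : Type*} [Fintype V] [DecidableEq V] {n : ℕ}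
    {X : WeightedComplex V} (hbal : X.IsBalanced n)
    (hconn : ∀ (τ : Finset V) (hτ : τ ∈ X.simplices), τ.card < n →
      (X.link τ hτ).oneSkeleton.Connected)
    {lam kap : ℝ} (hlam : ((n : ℝ) - 1) / n < lam) (hle : lam ≤ kap)
    (hspec : ∀ (τ : Finset V) (hτ : τ ∈ X.simplices), τ.card + 1 = n →
      spectrum ℝ ((X.link τ hτ).upperLaplacian 0) \ {0} ⊆ Set.Icc lam kap)
    {j k : ℕ} (hjk : k + j + 1 = n) :
    X.LocalGap k (descentMap^[j] lam) (descentMap^[j] kap) := by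
  induction j generalizing k with
  | zero =>
    -- No descent yet: here `k = n - 1` vertices span an `(n - 2)`-simplex, where the spectrum is
    -- given.
    refine localGap_of_eigenvalues hbal (by omega) hconn fun τ hτ μ g hμ hg heig => ?_
    refine hspec _ hτ.2 ?_ ⟨?_, hμ⟩
    · rw [Finset.card_image_of_injective _ hτ.1, Finset.card_univ, Fintype.card_fin]
      exact hjk
    · exact (Module.End.hasEigenvalue_of_hasEigenvector
        ⟨Module.End.mem_eigenspace_iff.2 heig, hg⟩).mem_spectrum
  | succ j ih =>
    rw [Function.iterate_succ_apply', Function.iterate_succ_apply']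
    have h1 := descentMap_iterate_pos hlam (by omega : j + 1 < n)
    exact (ih (by omega)).descend hbal (by omega) hconn h1
      (h1.trans_le (descentMap_iterate_mono hlam hle (by omega)))

theorem corollary6p3 {V : Type*} [Fintype V] [DecidableEq V] (n : ℕ) (hn : 1 < n)
    (X : WeightedComplex V) (hpure : X.IsPure n) (hbal : X.IsBalanced n)
    (hconn : ∀ (τ : Finset V) (hτ : τ ∈ X.simplices), τ.card < n →
      (X.link τ hτ).oneSkeleton.Connected)
    (lam kap : ℝ) (hlam : ((n : ℝ) - 1) / n < lam) (hle : lam ≤ kap)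
    (hspec : ∀ (τ : Finset V) (hτ : τ ∈ X.simplices), τ.card + 1 = n →
      spectrum ℝ ((X.link τ hτ).upperLaplacian 0) \ {0} ⊆ Set.Icc lam kap)
    (k : ℕ) (hk : k < n) :
    ‖LinearMap.toContinuousLinearMap
        (X.upperLaplacian k
          + ((descentMap^[n - 1 - k] lam + descentMap^[n - 1 - k] kap) / 2) • X.lowerLaplacian k
          - (((k : ℝ) + 1) *
              ((descentMap^[n - 1 - k] lam + descentMap^[n - 1 - k] kap) / 2
                - (k : ℝ) / ((k : ℝ) + 1))) • (1 : Module.End ℝ (X.Form (k + 1))))‖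
      ≤ ((k : ℝ) + 1) / 2 * (descentMap^[n - 1 - k] kap - descentMap^[n - 1 - k] lam) := by
  have hgap := WeightedComplex.localGap_iterate hbal hconn hlam hle hspec
    (j := n - 1 - k) (k := k) (by omega)
  have hmono := descentMap_iterate_mono hlam hle (j := n - 1 - k) (by omega)
  refine LinearMap.IsSymmetric.norm_le_of_abs_inner_le ?_ ?_ ?_
  · refine ((X.isSymmetric_upperLaplacian k).add
      ((X.isSymmetric_lowerLaplacian k).smul (by simp))).sub
      (LinearMap.IsSymmetric.smul (by simp) fun _ _ => rfl)
  · exact mul_nonneg (by positivity) (sub_nonneg.2 hmono)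
  · exact hgap.inner_bounds hbal hk hmono
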